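/- For natural numbers $k \ge 2$ and $n \ge 0$, let $$\mathcal{R}^n_k = \sum_{h_1+\cdots+h_k=n} \frac{n!}{h_1!\cdots h_k!}\prod_{v=1}^k \left(\frac{h_v}{n}\right)^{h_v}$$ be the regret (normalizing constant of the normalized maximum likelihood distribution) of the multinomial model with $k$ values and $n$ samples, where the sum runs over all $k$-tuples of natural numbers $h_v \ge 0$ with sum $n$, and $0^0 = 1$, so that for $n=0$ every factor $(h_v/n)^{h_v}$ is $1$ and $\mathcal{R}^0_k = 1$. Then, for every fixed $k \ge 2$, $\mathcal{R}^n_k$ is log-concave as a function of $n$: $\mathcal{R}^n_k > 0$ for all $n \ge 0$, and $$\mathcal{R}^{n-1}_k\,\mathcal{R}^{n+1}_k \le \left(\mathcal{R}^n_k\right)^2 \qquad \text{for all integers } n \ge 1.$$ -/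

import Mathlib

/-- The multinomial NML regret (Shtarkov normalizer) for a domain of `k` values and `n` samples:
the sum over all frequency vectors `(h_1, …, h_k)` of natural numbers with `h_1 + ⋯ + h_k = n` of
`n! / (h_1! ⋯ h_k!) * ∏ v, (h_v / n) ^ h_v`, with the convention `0 ^ 0 = 1`
(so that its value at `n = 0` is `1`). -/
noncomputable def nmlRegret (k n : ℕ) : ℝ :=
  ∑ h ∈ Finset.piAntidiag (Finset.univ : Finset (Fin k)) n,
    ((n.factorial : ℝ) / ∏ v, ((h v).factorial : ℝ)) * ∏ v, ((h v : ℝ) / (n : ℝ)) ^ (h v)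

/-- A sequence of real numbers indexed by `0, 1, 2, …` is log-concave: all terms are positive, and
`a (n - 1) * a (n + 1) ≤ a n ^ 2` for every `n ≥ 1`. -/
def IsLogConcaveSeq (a : ℕ → ℝ) : Prop :=
  (∀ n, 0 < a n) ∧ ∀ n, 1 ≤ n → a (n - 1) * a (n + 1) ≤ a n ^ 2

/-! ### Abel's identity and a single-sum formula for the regret -/

section

open Finset

/-! Log-concavity in `n` is inherited from an integrand. Abel's identity collapses the sum over
compositions to a single sum weighted by `multichoose` (`nmlRegret_succ_eq_sum`). Reading the
resulting factorials as Gamma integrals gives, for `k = m + 2`, the regret as `1 / m!` times the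
integral of `x ^ m * exp (-x) * (1 + x / n) ^ n` over the half-line
(`nmlRegret_add_two_eq_integral`).

This kernel is midpoint log-concave jointly in `(n, x)` (`regretKernel_mul_le`), and the
Prékopa–Leindler inequality (`integral_mul_integral_le_sq_of_mul_le_sq`) passes that to the
integrals. -/

theorem sum_piAntidiag_fin_succ {β : Type*} [AddCommMonoid β] (k n : ℕ)
    (F : (Fin (k + 1) → ℕ) → β) :
    ∑ h ∈ piAntidiag (univ : Finset (Fin (k + 1))) n, F h =
      ∑ p ∈ antidiagonal n, ∑ h ∈ piAntidiag (univ : Finset (Fin k)) p.2, F (Fin.cons p.1 h) := by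
  rw [sum_sigma']
  refine sum_nbij' (fun h => ⟨(h 0, ∑ i, Fin.tail h i), Fin.tail h⟩) (fun x => Fin.cons x.1.1 x.2)
    ?_ ?_ ?_ ?_ ?_
  · intro h hh
    simp only [mem_piAntidiag, Fin.sum_univ_succ] at hh
    simp [Fin.tail_def, ← hh.1]
  · rintro ⟨⟨a, b⟩, h⟩ hh
    simp only [mem_sigma, HasAntidiagonal.mem_antidiagonal, mem_piAntidiag] at hh
    simp [Fin.sum_univ_succ, hh.2.1, hh.1]
  · intro h _
    simp
  · rintro ⟨⟨a, b⟩, h⟩ hh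
    simp only [mem_sigma, HasAntidiagonal.mem_antidiagonal, mem_piAntidiag] at hh
    obtain ⟨-, rfl, -⟩ := hh
    simp
  · intro h _
    simp

theorem sum_antidiagonal_multichoose (k l : ℕ) :
    ∑ p ∈ antidiagonal l, k.multichoose p.1 = (k + 1).multichoose l := by
  rw [Nat.sum_antidiagonal_eq_sum_range_succ_mk]
  induction l with
  | zero => simp
  | succ l ih => rw [sum_range_succ, ih, Nat.multichoose_succ_succ, add_comm]

theorem sum_antidiagonal_sum_antidiagonal_snd {β : Type*} [AddCommMonoid β] (n : ℕ)
    (f : ℕ → ℕ → ℕ → β) :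
    ∑ p ∈ antidiagonal n, ∑ q ∈ antidiagonal p.2, f p.1 q.1 q.2 =
      ∑ p ∈ antidiagonal n, ∑ q ∈ antidiagonal p.1, f q.1 q.2 p.2 := by
  rw [sum_sigma', sum_sigma']
  refine sum_nbij' (fun x => ⟨(x.1.1 + x.2.1, x.2.2), (x.1.1, x.2.1)⟩)
    (fun x => ⟨(x.2.1, x.2.2 + x.1.2), (x.2.2, x.1.2)⟩) ?_ ?_ ?_ ?_ ?_
  all_goals
    rintro ⟨⟨a, b⟩, ⟨c, d⟩⟩ h
    simp only [mem_sigma, HasAntidiagonal.mem_antidiagonal] at h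
    obtain ⟨h1, h2⟩ := h
    subst h2
    first | rfl | simp [← h1, add_assoc]

/-- Cauchy's form of the Abel identity, in exponential normalisation. -/
theorem sum_antidiagonal_pow_self_mul_sub_pow (s : ℝ) (M : ℕ) :
    ∑ p ∈ antidiagonal M, ((p.1 : ℝ) ^ p.1 / p.1.factorial) * ((s - p.1) ^ p.2 / p.2.factorial)
      = ∑ p ∈ antidiagonal M, s ^ p.2 / p.2.factorial := by
  -- The `m`-th finite difference of `x ^ m` is `m!`, here evaluated at `0`.
  have alt (m : ℕ) : ∑ p ∈ antidiagonal m,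
      (p.1 : ℝ) ^ p.1 / p.1.factorial * ((-p.1 : ℝ) ^ p.2 / p.2.factorial) = 1 := by
    have h := congrFun (fwdDiff_iter_eq_factorial (R := ℝ) (n := m)) 0
    rw [fwdDiff_iter_eq_sum_shift] at h
    rw [Nat.sum_antidiagonal_eq_sum_range_succ_mk]
    have hm : (m.factorial : ℝ) ≠ 0 := by positivity
    refine mul_left_cancel₀ hm ?_
    rw [mul_one, mul_sum]
    refine Eq.trans (sum_congr rfl fun i hi => ?_) (h.trans (by simp))
    have him : i ≤ m := by simpa [Nat.lt_succ_iff] using hi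
    have h3 : (m.choose i : ℝ) = m.factorial / (i.factorial * (m - i).factorial) :=
      Nat.cast_choose ℝ him
    have h4 : (i : ℝ) ^ m = (i : ℝ) ^ i * (i : ℝ) ^ (m - i) := by
      rw [← pow_add, Nat.add_sub_cancel' him]
    simp only [zsmul_eq_mul, nsmul_eq_mul, mul_one, zero_add, Int.cast_mul, Int.cast_pow,
      Int.cast_neg, Int.cast_one, Int.cast_natCast]
    rw [h3, h4, neg_pow (i : ℝ)]
    field_simp
  have binom (i j : ℕ) : (s - i) ^ j / (j.factorial : ℝ) =
      ∑ q ∈ antidiagonal j, (-i : ℝ) ^ q.1 / q.1.factorial * (s ^ q.2 / q.2.factorial) := by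
    rw [sub_eq_neg_add, (Commute.all _ _).add_pow', sum_div]
    refine sum_congr rfl fun q hq => ?_
    have hq' : q.1 + q.2 = j := HasAntidiagonal.mem_antidiagonal.mp hq
    subst hq'
    rw [nsmul_eq_mul, Nat.cast_add_choose]
    have : ((q.1 + q.2).factorial : ℝ) ≠ 0 := by positivity
    field_simp
  simp_rw [binom, mul_sum]
  rw [sum_antidiagonal_sum_antidiagonal_snd M fun i j l => (i : ℝ) ^ i / i.factorial *
    ((-i : ℝ) ^ j / j.factorial * (s ^ l / l.factorial))]
  simp_rw [← mul_assoc, ← sum_mul, alt, one_mul]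

/-- Induction on the number of parts: splitting off a part and applying Abel's identity replaces its
weight `a ^ a / a!` by `1`, so each extra part only sums `multichoose` once more. -/
theorem sum_piAntidiag_prod_pow_self_div_factorial (k n : ℕ) :
    ∑ h ∈ piAntidiag (univ : Finset (Fin (k + 1))) n,
        ∏ v, ((h v : ℝ) ^ h v / (h v).factorial) =
      ∑ p ∈ antidiagonal n, (k.multichoose p.1 : ℝ) * ((n : ℝ) ^ p.2 / p.2.factorial) := by
  induction k generalizing n with
  | zero =>
    have h1 : ∑ p ∈ antidiagonal n,
        ((Nat.multichoose 0 p.1 : ℕ) : ℝ) * ((n : ℝ) ^ p.2 / p.2.factorial) =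
          (n : ℝ) ^ n / n.factorial := by
      rw [Nat.sum_antidiagonal_eq_sum_range_succ_mk, sum_range_succ']
      simp
    rw [h1, sum_piAntidiag_fin_succ, sum_eq_single (n, 0)]
    · simp
    · rintro ⟨a, b⟩ hab hne
      have hb : b ≠ 0 := by
        rintro rfl
        exact hne (by simpa using hab)
      simp [piAntidiag_empty_of_ne_zero hb]
    · simp
  | succ k ih =>
    rw [sum_piAntidiag_fin_succ]
    -- Abel's identity at `s = n`, since `n - q.1 = p.1 + q.2`.
    have cauchy : ∀ p ∈ antidiagonal n, ∑ q ∈ antidiagonal p.2,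
        ((q.1 : ℝ) ^ q.1 / q.1.factorial) * ((p.1 + q.2 : ℕ) ^ q.2 / q.2.factorial : ℝ) =
          ∑ q ∈ antidiagonal p.2, (n : ℝ) ^ q.2 / q.2.factorial := by
      intro p hp
      rw [← sum_antidiagonal_pow_self_mul_sub_pow]
      refine sum_congr rfl fun q hq => ?_
      have hp := HasAntidiagonal.mem_antidiagonal.mp hp
      have hq := HasAntidiagonal.mem_antidiagonal.mp hq
      rw [← hp, ← hq]
      push_cast
      ring
    calc _ = ∑ p ∈ antidiagonal n, ∑ q ∈ antidiagonal p.2, (k.multichoose q.1 : ℝ) *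
          (((p.1 : ℝ) ^ p.1 / p.1.factorial) *
            ((q.1 + q.2 : ℕ) ^ q.2 / q.2.factorial : ℝ)) := by
          refine sum_congr rfl fun p _ => ?_
          simp only [Fin.prod_univ_succ (n := k + 1), Fin.cons_zero, Fin.cons_succ]
          rw [← mul_sum, ih, mul_sum]
          refine sum_congr rfl fun q hq => ?_
          rw [HasAntidiagonal.mem_antidiagonal.mp hq]
          ring
      _ = ∑ p ∈ antidiagonal n, ∑ q ∈ antidiagonal p.2, (k.multichoose p.1 : ℝ) *
          (((q.1 : ℝ) ^ q.1 / q.1.factorial) *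
            ((p.1 + q.2 : ℕ) ^ q.2 / q.2.factorial : ℝ)) := by
          rw [sum_antidiagonal_sum_antidiagonal_snd n fun a b c => (k.multichoose b : ℝ) *
              (((a : ℝ) ^ a / a.factorial) * ((b + c : ℕ) ^ c / c.factorial : ℝ)),
            sum_antidiagonal_sum_antidiagonal_snd n fun b a c => (k.multichoose b : ℝ) *
              (((a : ℝ) ^ a / a.factorial) * ((b + c : ℕ) ^ c / c.factorial : ℝ))]
          refine sum_congr rfl fun p _ => ?_
          rw [← Nat.sum_antidiagonal_swap]
          rfl
      _ = ∑ p ∈ antidiagonal n, ∑ q ∈ antidiagonal p.2, (k.multichoose p.1 : ℝ) *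
          ((n : ℝ) ^ q.2 / q.2.factorial) := by
          refine sum_congr rfl fun p hp => ?_
          rw [← mul_sum, ← mul_sum, cauchy p hp]
      _ = _ := by
          rw [sum_antidiagonal_sum_antidiagonal_snd n fun b _ c => (k.multichoose b : ℝ) *
            ((n : ℝ) ^ c / c.factorial)]
          refine sum_congr rfl fun p _ => ?_
          rw [← sum_mul, ← sum_antidiagonal_multichoose]
          push_cast
          rfl

theorem nmlRegret_succ_eq_sum (k n : ℕ) :
    nmlRegret (k + 1) n = ∑ p ∈ antidiagonal n,
      (k.multichoose p.1 : ℝ) * (n.factorial / p.2.factorial / (n : ℝ) ^ p.1) := by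
  have hn : (n : ℝ) ^ n ≠ 0 := by
    rcases eq_or_ne n 0 with rfl | h
    · simp
    · positivity
  calc nmlRegret (k + 1) n = n.factorial / (n : ℝ) ^ n *
        ∑ h ∈ piAntidiag (univ : Finset (Fin (k + 1))) n,
          ∏ v, ((h v : ℝ) ^ h v / (h v).factorial) := by
        rw [nmlRegret, mul_sum]
        refine sum_congr rfl fun h hh => ?_
        have hs : ∑ v, h v = n := (mem_piAntidiag.mp hh).1
        simp_rw [div_pow, prod_div_distrib]
        rw [prod_pow_eq_pow_sum, hs]
        ring
    _ = _ := by
        rw [sum_piAntidiag_prod_pow_self_div_factorial, mul_sum]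
        refine sum_congr rfl fun p hp => ?_
        have hs := HasAntidiagonal.mem_antidiagonal.mp hp
        have h1 : (n : ℝ) ^ n = (n : ℝ) ^ p.1 * (n : ℝ) ^ p.2 := by rw [← pow_add, hs]
        rw [h1] at hn ⊢
        have h2 := left_ne_zero_of_mul hn
        have h3 := right_ne_zero_of_mul hn
        field_simp

end

/-! ### Brunn–Minkowski and Prékopa–Leindler on the half-line -/

section

open MeasureTheory Set Filter Topology
open scoped ENNReal Pointwise

/-- The one-dimensional Brunn–Minkowski inequality. -/
theorem IsCompact.volume_add_volume_le {A B : Set ℝ} (hA : IsCompact A) (hB : IsCompact B)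
    (hA' : A.Nonempty) (hB' : B.Nonempty) : volume A + volume B ≤ volume (A + B) := by
  obtain ⟨a, haA, ha⟩ := hA.exists_isGreatest hA'
  obtain ⟨b, hbB, hb⟩ := hB.exists_isLeast hB'
  -- With `a = max A` and `b = min B`, these translates meet only at `a + b`.
  have hsub : ((· + b) '' A) ∪ ((a + ·) '' B) ⊆ A + B := by
    rintro _ (⟨x, hx, rfl⟩ | ⟨x, hx, rfl⟩)
    · exact add_mem_add hx hbB
    · exact add_mem_add haA hx
  have hdisj : AEDisjoint volume ((· + b) '' A) ((a + ·) '' B) := by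
    refine measure_mono_null (t := {a + b}) ?_ (by simp)
    rintro _ ⟨⟨x, hx, rfl⟩, ⟨y, hy, hxy⟩⟩
    have h1 := ha hx
    have h2 := hb hy
    simp only [mem_singleton_iff] at *
    linarith
  have hBm : MeasurableSet ((a + ·) '' B) :=
    (hB.image (by fun_prop)).measurableSet
  calc volume A + volume B = volume ((· + b) '' A) + volume ((a + ·) '' B) := by
        simp [image_add_right, image_add_left]
    _ = volume (((· + b) '' A) ∪ ((a + ·) '' B)) :=
        (measure_union₀ hBm.nullMeasurableSet hdisj).symm
    _ ≤ _ := measure_mono hsub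

theorem isCompact_setOf_le_inter_Ici {f : ℝ → ℝ} (hf : ContinuousOn f (Ici 0))
    (hlim : Tendsto f atTop (𝓝 0)) {t : ℝ} (ht : 0 < t) : IsCompact ({x | t ≤ f x} ∩ Ici 0) := by
  obtain ⟨C, hC⟩ := eventually_atTop.mp (hlim.eventually_lt_const ht)
  have hcl : IsClosed (Ici (0 : ℝ) ∩ f ⁻¹' Ici t) :=
    hf.preimage_isClosed_of_isClosed isClosed_Ici isClosed_Ici
  rw [inter_comm]
  refine (isCompact_Icc (a := (0 : ℝ)) (b := C)).of_isClosed_subset hcl ?_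
  rintro x ⟨hx, hx'⟩
  refine ⟨hx, le_of_not_gt fun h => ?_⟩
  exact absurd (hC x h.le) (not_lt.mpr hx')

theorem lintegral_Ici_eq_lintegral_volume {f : ℝ → ℝ} (hf : ContinuousOn f (Ici 0))
    (h0 : ∀ x, 0 ≤ x → 0 ≤ f x) :
    ∫⁻ x in Ici 0, ENNReal.ofReal (f x) =
      ∫⁻ t in Ioi 0, volume ({x | t ≤ f x} ∩ Ici 0) := by
  rw [lintegral_eq_lintegral_meas_le]
  · simp_rw [Measure.restrict_apply' (measurableSet_Ici (a := (0 : ℝ)))]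
  · exact ae_restrict_of_forall_mem measurableSet_Ici h0
  · exact hf.aemeasurable measurableSet_Ici

/-- The Prékopa–Leindler inequality on the half-line, for functions with maximum one. -/
theorem lintegral_add_lintegral_le_of_mul_le_sq {f g h : ℝ → ℝ}
    (hf : ContinuousOn f (Ici 0)) (hg : ContinuousOn g (Ici 0)) (hh : ContinuousOn h (Ici 0))
    (hf0 : ∀ x, 0 ≤ x → 0 ≤ f x) (hg0 : ∀ x, 0 ≤ x → 0 ≤ g x) (hh0 : ∀ x, 0 ≤ x → 0 ≤ h x)
    (hfl : Tendsto f atTop (𝓝 0)) (hgl : Tendsto g atTop (𝓝 0))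
    (hfM : IsGreatest (f '' Ici 0) 1) (hgM : IsGreatest (g '' Ici 0) 1)
    (hfgh : ∀ x y, 0 ≤ x → 0 ≤ y → f x * g y ≤ h ((x + y) / 2) ^ 2) :
    (∫⁻ x in Ici 0, ENNReal.ofReal (f x)) + ∫⁻ x in Ici 0, ENNReal.ofReal (g x) ≤
      2 * ∫⁻ x in Ici 0, ENNReal.ofReal (h x) := by
  rw [lintegral_Ici_eq_lintegral_volume hf hf0, lintegral_Ici_eq_lintegral_volume hg hg0,
    lintegral_Ici_eq_lintegral_volume hh hh0, ← lintegral_const_mul' _ _ (by simp),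
    ← lintegral_add_left]
  · refine setLIntegral_mono' measurableSet_Ioi fun t ht => ?_
    have ht : 0 < t := ht
    -- Brunn–Minkowski needs nonempty sets. Equal maxima make both superlevel sets nonempty for `t ≤
    -- 1` and both empty above.
    rcases lt_or_ge 1 t with h1 | h1
    · have he {u : ℝ → ℝ} (hu : IsGreatest (u '' Ici 0) 1) :
          {x | t ≤ u x} ∩ Ici 0 = ∅ := by
        refine eq_empty_of_forall_notMem fun x hx => ?_
        have := hu.2 (mem_image_of_mem u hx.2)
        have h2 : t ≤ u x := hx.1
        linarith
      simp [he hfM, he hgM]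
    · have hne {u : ℝ → ℝ} (hu : IsGreatest (u '' Ici 0) 1) :
          ({x | t ≤ u x} ∩ Ici 0).Nonempty := by
        obtain ⟨x, hx, hux⟩ := hu.1
        exact ⟨x, by simpa [hux] using h1, hx⟩
      refine ((isCompact_setOf_le_inter_Ici hf hfl ht).volume_add_volume_le
        (isCompact_setOf_le_inter_Ici hg hgl ht) (hne hfM) (hne hgM)).trans ?_
      have h2 : (2 : ℝ≥0∞) * volume ({x | t ≤ h x} ∩ Ici 0) =
          volume ((2 : ℝ) • ({x | t ≤ h x} ∩ Ici 0)) := by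
        rw [Measure.addHaar_smul]
        simp
      rw [h2]
      refine measure_mono ?_
      rintro _ ⟨x, ⟨hx, hx0⟩, y, ⟨hy, hy0⟩, rfl⟩
      have hx : t ≤ f x := hx
      have hy : t ≤ g y := hy
      have hx0 : 0 ≤ x := hx0
      have hy0 : 0 ≤ y := hy0
      have hxy : 0 ≤ (x + y) / 2 := by positivity
      refine ⟨(x + y) / 2, ⟨?_, hxy⟩, by simp; ring⟩
      refine (pow_le_pow_iff_left₀ ht.le (hh0 _ hxy) two_ne_zero).mp ?_
      calc t ^ 2 = t * t := sq t
        _ ≤ f x * g y := mul_le_mul hx hy ht.le (ht.le.trans hx)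
        _ ≤ _ := hfgh x y hx0 hy0
  · refine Antitone.measurable fun s t hst => measure_mono ?_
    exact inter_subset_inter_left _ fun x hx => le_trans hst hx

theorem exists_pos_isGreatest_image_Ici {f : ℝ → ℝ} (hf : ContinuousOn f (Ici 0))
    (hfl : Tendsto f atTop (𝓝 0)) (hpos : ∃ x, 0 ≤ x ∧ 0 < f x) :
    ∃ M, 0 < M ∧ IsGreatest (f '' Ici 0) M := by
  obtain ⟨x, hx, hfx⟩ := hpos
  obtain ⟨y, hy, hmax⟩ := (isCompact_setOf_le_inter_Ici hf hfl hfx).exists_isMaxOn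
    ⟨x, le_refl (f x), hx⟩ (hf.mono inter_subset_right)
  have hy1 : f x ≤ f y := hy.1
  refine ⟨f y, hfx.trans_le hy1, ⟨y, hy.2, rfl⟩, ?_⟩
  rintro _ ⟨z, hz, rfl⟩
  rcases le_total (f x) (f z) with h | h
  · exact hmax ⟨h, hz⟩
  · exact h.trans hy1

/-- The Prékopa–Leindler inequality on the half-line (midpoint form). -/
theorem integral_mul_integral_le_sq_of_mul_le_sq {f g h : ℝ → ℝ}
    (hf : ContinuousOn f (Ici 0)) (hg : ContinuousOn g (Ici 0)) (hh : ContinuousOn h (Ici 0))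
    (hf0 : ∀ x, 0 ≤ x → 0 ≤ f x) (hg0 : ∀ x, 0 ≤ x → 0 ≤ g x) (hh0 : ∀ x, 0 ≤ x → 0 ≤ h x)
    (hfl : Tendsto f atTop (𝓝 0)) (hgl : Tendsto g atTop (𝓝 0))
    (hfi : IntegrableOn f (Ici 0)) (hgi : IntegrableOn g (Ici 0)) (hhi : IntegrableOn h (Ici 0))
    (hfpos : ∃ x, 0 ≤ x ∧ 0 < f x) (hgpos : ∃ x, 0 ≤ x ∧ 0 < g x)
    (hfgh : ∀ x y, 0 ≤ x → 0 ≤ y → f x * g y ≤ h ((x + y) / 2) ^ 2) :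
    (∫ x in Ici 0, f x) * (∫ x in Ici 0, g x) ≤ (∫ x in Ici 0, h x) ^ 2 := by
  obtain ⟨M, hM, hfM⟩ := exists_pos_isGreatest_image_Ici hf hfl hfpos
  obtain ⟨N, hN, hgN⟩ := exists_pos_isGreatest_image_Ici hg hgl hgpos
  have hMN : 0 < M * N := mul_pos hM hN
  have hs : 0 < √(M * N) := Real.sqrt_pos.mpr hMN
  have hss : √(M * N) ^ 2 = M * N := Real.sq_sqrt hMN.le
  have hgreatest {u : ℝ → ℝ} {K : ℝ} (hK : 0 < K) (hu : IsGreatest (u '' Ici 0) K) :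
      IsGreatest ((fun x => u x / K) '' Ici 0) 1 := by
    obtain ⟨⟨x, hx, hux⟩, hu⟩ := hu
    refine ⟨⟨x, hx, by simp [hux, hK.ne']⟩, ?_⟩
    rintro _ ⟨z, hz, rfl⟩
    exact (div_le_one hK).mpr (hu ⟨z, hz, rfl⟩)
  have key := lintegral_add_lintegral_le_of_mul_le_sq (hf.div_const M) (hg.div_const N)
    (hh.div_const √(M * N)) (fun x hx => div_nonneg (hf0 x hx) hM.le)
    (fun x hx => div_nonneg (hg0 x hx) hN.le) (fun x hx => div_nonneg (hh0 x hx) hs.le)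
    (by simpa using hfl.div_const M) (by simpa using hgl.div_const N)
    (hgreatest hM hfM) (hgreatest hN hgN) (fun x y hx hy => by
      rw [div_pow, hss, div_mul_div_comm]
      exact div_le_div_of_nonneg_right (hfgh x y hx hy) hMN.le)
  have conv {u : ℝ → ℝ} {K : ℝ} (hK : 0 < K) (hu0 : ∀ x, 0 ≤ x → 0 ≤ u x)
      (hui : IntegrableOn u (Ici 0)) : ∫⁻ x in Ici 0, ENNReal.ofReal (u x / K) =
        ENNReal.ofReal ((∫ x in Ici 0, u x) / K) := by
    rw [← integral_div, ofReal_integral_eq_lintegral_ofReal (hui.div_const K)]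
    exact ae_restrict_of_forall_mem measurableSet_Ici fun x hx => div_nonneg (hu0 x hx) hK.le
  have hnn {u : ℝ → ℝ} (hu0 : ∀ x, 0 ≤ x → 0 ≤ u x) : 0 ≤ ∫ x in Ici 0, u x :=
    setIntegral_nonneg measurableSet_Ici hu0
  rw [conv hM hf0 hfi, conv hN hg0 hgi, conv hs hh0 hhi] at key
  have hF := hnn hf0
  have hG := hnn hg0
  have hH := hnn hh0
  set F := ∫ x in Ici 0, f x
  set G := ∫ x in Ici 0, g x
  set H := ∫ x in Ici 0, h x
  rw [← ENNReal.ofReal_add (by positivity) (by positivity), ← ENNReal.ofReal_ofNat,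
    ← ENNReal.ofReal_mul (by norm_num), ENNReal.ofReal_le_ofReal_iff (by positivity)] at key
  -- AM-GM turns the additive bound for the normalised functions into a product bound, in which `M *
  -- N` cancels.
  have h1 : 4 * (F / M * (G / N)) ≤ (2 * (H / √(M * N))) ^ 2 := by
    refine le_trans ?_ (pow_le_pow_left₀ (by positivity) key 2)
    nlinarith [sq_nonneg (F / M - G / N)]
  rw [mul_pow, div_pow, hss, div_mul_div_comm] at h1
  have h2 : F * G / (M * N) ≤ H ^ 2 / (M * N) := by linarith
  exact (div_le_div_iff_of_pos_right hMN).mp h2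

end

/-! ### Integral representation and joint log-concavity of the kernel -/

section

open MeasureTheory Set Filter Topology

/-- The integrand in the integral representation of `nmlRegret (m + 2) n`. -/
noncomputable def regretKernel (m n : ℕ) (x : ℝ) : ℝ :=
  x ^ m * Real.exp (-x) * (1 + x / n) ^ n

theorem regretKernel_eq_sum (m n : ℕ) (x : ℝ) :
    regretKernel m n x = ∑ p ∈ Finset.HasAntidiagonal.antidiagonal n,
      n.factorial / (p.1.factorial * p.2.factorial) / (n : ℝ) ^ p.1 *
        (x ^ (m + p.1) * Real.exp (-x)) := by
  rw [regretKernel, add_comm 1, (Commute.all _ _).add_pow', Finset.mul_sum]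
  refine Finset.sum_congr rfl fun p hp => ?_
  have hp' : p.1 + p.2 = n := Finset.HasAntidiagonal.mem_antidiagonal.mp hp
  have hc : (n.choose p.1 : ℝ) = n.factorial / (p.1.factorial * p.2.factorial) := by
    rw [← hp', Nat.cast_add_choose]
  rw [nsmul_eq_mul, hc, div_pow, pow_add]
  ring

theorem integrableOn_pow_mul_exp_neg (j : ℕ) :
    IntegrableOn (fun x : ℝ => x ^ j * Real.exp (-x)) (Ici 0) := by
  rw [integrableOn_Ici_iff_integrableOn_Ioi]
  have h := Real.GammaIntegral_convergent (s := (j : ℝ) + 1) (by positivity)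
  refine h.congr_fun (fun x _ => ?_) measurableSet_Ioi
  simp [mul_comm]

theorem integral_Ici_pow_mul_exp_neg (j : ℕ) :
    ∫ x in Ici (0 : ℝ), x ^ j * Real.exp (-x) = j.factorial := by
  rw [integral_Ici_eq_integral_Ioi, ← Real.Gamma_nat_eq_factorial,
    Real.Gamma_eq_integral (by positivity)]
  refine setIntegral_congr_fun measurableSet_Ioi fun x _ => ?_
  simp [mul_comm]

theorem integrableOn_regretKernel (m n : ℕ) : IntegrableOn (regretKernel m n) (Ici 0) := by
  simp_rw [funext (regretKernel_eq_sum m n)]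
  exact integrable_finsetSum _ fun p _ => (integrableOn_pow_mul_exp_neg _).const_mul _

theorem tendsto_regretKernel_atTop (m n : ℕ) :
    Tendsto (regretKernel m n) atTop (𝓝 0) := by
  rw [funext (regretKernel_eq_sum m n)]
  simpa using tendsto_finsetSum (Finset.HasAntidiagonal.antidiagonal n) fun p _ =>
    (Real.tendsto_pow_mul_exp_neg_atTop_nhds_zero (m + p.1)).const_mul
      (n.factorial / (p.1.factorial * p.2.factorial) / (n : ℝ) ^ p.1)

theorem continuous_regretKernel (m n : ℕ) : Continuous (regretKernel m n) := by
  unfold regretKernel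
  fun_prop

theorem regretKernel_nonneg (m n : ℕ) {x : ℝ} (hx : 0 ≤ x) : 0 ≤ regretKernel m n x := by
  unfold regretKernel
  positivity

theorem exists_regretKernel_pos (m n : ℕ) : ∃ x, 0 ≤ x ∧ 0 < regretKernel m n x :=
  ⟨1, zero_le_one, by unfold regretKernel; positivity⟩

theorem nmlRegret_add_two_eq_integral (m n : ℕ) :
    nmlRegret (m + 2) n = (∫ x in Ici 0, regretKernel m n x) / m.factorial := by
  simp_rw [regretKernel_eq_sum]
  rw [integral_finsetSum _ fun p _ => (integrableOn_pow_mul_exp_neg _).const_mul _,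
    nmlRegret_succ_eq_sum, Finset.sum_div]
  refine Finset.sum_congr rfl fun p _ => ?_
  rw [integral_const_mul, integral_Ici_pow_mul_exp_neg, Nat.multichoose_eq,
    show m + 1 + p.1 - 1 = m + p.1 by lia, Nat.choose_symm_add.symm, Nat.cast_add_choose]
  field_simp

/-- Joint log-concavity in `(n, x)` of `(1 + x / n) ^ n`, including its limit at `n = 0`. -/
theorem one_add_div_pow_mul_le (n : ℕ) {x y : ℝ} (hx : 0 ≤ x) (hy : 0 ≤ y) :
    (1 + x / n) ^ n * (1 + y / ↑(n + 2)) ^ (n + 2) ≤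
      ((1 + (x + y) / 2 / ↑(n + 1)) ^ (n + 1)) ^ 2 := by
  set p := 1 + x / n with hp
  set q := 1 + y / ↑(n + 2) with hq
  have hp0 : 0 ≤ p := by positivity
  have hq0 : 0 ≤ q := by positivity
  have hN : (0 : ℝ) < 2 * (n + 1) := by positivity
  -- Weights chosen so that raising to the power `2 * (n + 1)` leaves exponents `n` and `n + 2`.
  have amgm := Real.geom_mean_le_arith_mean2_weighted (w₁ := n / (2 * (n + 1)))
    (w₂ := (n + 2) / (2 * (n + 1))) (by positivity) (by positivity) hp0 hq0
    (by field_simp; ring)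
  -- Only an inequality: at `n = 0` the left side is `0`.
  have h1 : (n : ℝ) * p ≤ n + x := by
    rcases eq_or_ne n 0 with rfl | h
    · simpa using hx
    · rw [hp]
      field_simp
      rfl
  have h2 : ((n : ℝ) + 2) * q = n + 2 + y := by
    rw [hq]
    push_cast
    field_simp
  have hmean : n / (2 * (n + 1)) * p + (n + 2) / (2 * (n + 1)) * q ≤
      1 + (x + y) / 2 / ↑(n + 1) := by
    calc n / (2 * (n + 1)) * p + (n + 2) / (2 * (n + 1)) * q
        = (n * p + (n + 2) * q) / (2 * (n + 1)) := by ring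
      _ ≤ (n + x + (n + 2 + y)) / (2 * (n + 1)) := by rw [h2]; gcongr
      _ = _ := by push_cast; field_simp; ring
  have hpow := pow_le_pow_left₀ (by positivity) (amgm.trans hmean) (2 * (n + 1))
  rw [mul_pow, ← Real.rpow_natCast (p ^ _), ← Real.rpow_natCast (q ^ _), ← Real.rpow_mul hp0,
    ← Real.rpow_mul hq0] at hpow
  push_cast at hpow
  rw [div_mul_cancel₀ _ hN.ne', div_mul_cancel₀ _ hN.ne', Real.rpow_natCast] at hpow
  rw [← pow_mul, mul_comm (n + 1)]
  push_cast
  exact_mod_cast hpow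

theorem regretKernel_mul_le (m n : ℕ) {x y : ℝ} (hx : 0 ≤ x) (hy : 0 ≤ y) :
    regretKernel m n x * regretKernel m (n + 2) y ≤ regretKernel m (n + 1) ((x + y) / 2) ^ 2 := by
  have hxy : x ^ m * y ^ m ≤ (((x + y) / 2) ^ m) ^ 2 := by
    rw [← mul_pow, ← pow_mul, mul_comm m, pow_mul]
    exact pow_le_pow_left₀ (by positivity) (by nlinarith [sq_nonneg (x - y)]) m
  have hexp : Real.exp (-x) * Real.exp (-y) = Real.exp (-((x + y) / 2)) ^ 2 := by
    rw [← Real.exp_add, ← Real.exp_nat_mul]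
    congr 1
    push_cast
    ring
  calc regretKernel m n x * regretKernel m (n + 2) y
      = x ^ m * y ^ m * (Real.exp (-x) * Real.exp (-y)) *
          ((1 + x / n) ^ n * (1 + y / ↑(n + 2)) ^ (n + 2)) := by
        unfold regretKernel
        ring
    _ ≤ (((x + y) / 2) ^ m) ^ 2 * Real.exp (-((x + y) / 2)) ^ 2 *
          ((1 + (x + y) / 2 / ↑(n + 1)) ^ (n + 1)) ^ 2 := by
        rw [hexp]
        exact mul_le_mul (mul_le_mul_of_nonneg_right hxy (by positivity))
          (one_add_div_pow_mul_le n hx hy) (by positivity) (by positivity)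
    _ = _ := by
        unfold regretKernel
        ring

theorem nmlRegret_pos {k : ℕ} (hk : 1 ≤ k) (n : ℕ) : 0 < nmlRegret k n := by
  obtain ⟨k, rfl⟩ := Nat.exists_eq_add_of_le' hk
  rw [nmlRegret_succ_eq_sum]
  refine Finset.sum_pos' (fun p _ => by positivity) ⟨(0, n), by simp, ?_⟩
  simp [Nat.factorial_ne_zero]

end

theorem lemma1 (k : ℕ) (hk : 2 ≤ k) : IsLogConcaveSeq (fun n : ℕ => nmlRegret k n) := by
  refine ⟨nmlRegret_pos (by lia), fun n hn => ?_⟩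
  obtain ⟨m, rfl⟩ := Nat.exists_eq_add_of_le' hk
  obtain ⟨n, rfl⟩ := Nat.exists_eq_add_of_le' hn
  simp only [Nat.add_sub_cancel, nmlRegret_add_two_eq_integral]
  rw [div_mul_div_comm, div_pow, ← sq]
  refine div_le_div_of_nonneg_right ?_ (by positivity)
  exact integral_mul_integral_le_sq_of_mul_le_sq
    (continuous_regretKernel m n).continuousOn (continuous_regretKernel m (n + 2)).continuousOn
    (continuous_regretKernel m (n + 1)).continuousOn
    (fun _ => regretKernel_nonneg m n) (fun _ => regretKernel_nonneg m (n + 2))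
    (fun _ => regretKernel_nonneg m (n + 1))
    (tendsto_regretKernel_atTop m n) (tendsto_regretKernel_atTop m (n + 2))
    (integrableOn_regretKernel m n) (integrableOn_regretKernel m (n + 2))
    (integrableOn_regretKernel m (n + 1))
    (exists_regretKernel_pos m n) (exists_regretKernel_pos m (n + 2))
    (fun _ _ => regretKernel_mul_le m n)
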